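/- **Lemma (NP $\subseteq \exists\mathbb{R}$).** Every decision problem in $\mathrm{NP}$ lies in $\exists\mathbb{R}$. Here a decision problem is a set $P\subseteq\{0,1\}^*$ of finite binary strings, and "polynomial time" means: on a deterministic multitape Turing machine whose tapes are stacks, in a number of steps bounded by a polynomial in the length of the input. * $P\in\mathrm{NP}$ if there are a polynomial $p$ and a polynomial-time algorithm $A$ with yes/no output such that for every instance $I\in\{0,1\}^*$ $$I\in P\iff \exists\, w\in\{0,1\}^*,\ |w|\le p(|I|),\ A(I,w)=1.$$ * $\mathrm{ETR}$ (existential theory of the reals) is the following decision problem. An instance is a quantifier-free formula $\varphi(x_0,\dots,x_n)$ built with "and", "or", "not" from constraints $q(x_0,\dots,x_n)\mathrel{R}0$, where $R\in\{<,\le,=,\ge,>\}$ and $q$ is a polynomial with integer coefficients, given as a sum of monomials; formulas are encoded as binary strings, with all coefficients, exponents and variable indices written in binary. It is a yes-instance if there are real numbers $x_0,\dots,x_n$ for which $\varphi(x_0,\dots,x_n)$ holds. * $P\in\exists\mathbb{R}$ if $P$ reduces to $\mathrm{ETR}$ in polynomial time, that is, there is a polynomial-time computable function $f:\{0,1\}^*\to\{0,1\}^*$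 such that for every $I\in\{0,1\}^*$: $I\in P\iff f(I)\in\mathrm{ETR}$. -/

import Mathlib

namespace ExistsReal

/-! ### Decision problems and polynomial time

A decision problem is a language over the binary alphabet, that is, a set of finite binary strings.
Polynomial time refers to Mathlib's deterministic Turing machines with finitely many stacks (each
stack is a half-tape, so these are multitape Turing machines) and one time unit per step. -/

/-- A function on binary strings that some deterministic Turing machine computes in a number of
steps bounded by a polynomial in the length of the input. -/
def PolyTimeFun (f : List Bool → List Bool) : Prop :=
  Nonempty (Turing.TM2ComputableInPolyTime
    (Computability.encodingList Bool).encode (Computability.encodingList Bool).encode f)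

/-- A yes/no question about pairs of binary strings that some deterministic Turing machine decides
in a number of steps bounded by a polynomial in the length of the input. The pair `(x, w)` is
written on the input tape as `x` followed by `w`, in two disjoint copies of the binary alphabet. -/
def PolyTimeVerifier (A : List Bool × List Bool → Bool) : Prop :=
  Nonempty (Turing.TM2ComputableInPolyTime
    (Computability.encodingProd (Computability.encodingList Bool)
      (Computability.encodingList Bool)).encode
    Computability.encodingBoolBool.encode A)

/-- Polynomial-time many-one (Karp) reductions between decision problems. -/
def PolyTimeReducible (P Q : Language Bool) : Prop :=
  ∃ f : List Bool → List Bool, PolyTimeFun f ∧ ∀ x, x ∈ P ↔ f x ∈ Q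

/-- The class `NP`: the yes-instances are those that have a witness, of length polynomially bounded
in the length of the instance, which a polynomial-time algorithm accepts. -/
def NP : Set (Language Bool) :=
  {P | ∃ (A : List Bool × List Bool → Bool) (p : Polynomial ℕ), PolyTimeVerifier A ∧
    ∀ x, x ∈ P ↔ ∃ w : List Bool, w.length ≤ p.eval x.length ∧ A (x, w) = true}

/-! ### The existential theory of the reals -/

/-- A polynomial with integer coefficients, written out as a sum of monomials
`c * x_{i₁} ^ e₁ * ⋯ * x_{iₖ} ^ eₖ`. A monomial is the pair of its coefficient `c` and the list of
the pairs `(iⱼ, eⱼ)`. The empty list of monomials is the zero polynomial. -/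
abbrev Poly : Type := List (ℤ × List (ℕ × ℕ))

/-- The value of a polynomial at a real point. -/
def Poly.eval (x : ℕ → ℝ) (p : Poly) : ℝ :=
  (p.map fun m => (m.1 : ℝ) * (m.2.map fun v => x v.1 ^ v.2).prod).sum

/-- The relation symbols `<`, `≤`, `=`, `≥`, `>`. -/
inductive Rel : Type
  | lt
  | le
  | eq
  | ge
  | gt

/-- `R.Holds a` says that `a R 0`. -/
def Rel.Holds : Rel → ℝ → Prop
  | .lt, a => a < 0
  | .le, a => a ≤ 0
  | .eq, a => a = 0
  | .ge, a => a ≥ 0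
  | .gt, a => a > 0

/-- Quantifier-free formulas: Boolean combinations of polynomial constraints `p R 0`. -/
inductive Formula : Type
  | atom (R : Rel) (p : Poly)
  | not (φ : Formula)
  | and (φ ψ : Formula)
  | or (φ ψ : Formula)

/-- The truth value of a formula at a real point. -/
def Formula.Holds (x : ℕ → ℝ) : Formula → Prop
  | .atom R p => R.Holds (p.eval x)
  | .not φ => ¬ φ.Holds x
  | .and φ ψ => φ.Holds x ∧ ψ.Holds x
  | .or φ ψ => φ.Holds x ∨ ψ.Holds x

/-! ### Binary encoding of formulas

Numbers are written in binary; all codes are self-delimiting. -/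

/-- The binary digits of `n`, each preceded by `true`, and a final `false`. -/
def encNat (n : ℕ) : List Bool :=
  (Computability.encodeNat n).flatMap (fun b => [true, b]) ++ [false]

/-- A sign bit (`true` for negative numbers), then the absolute value. -/
def encInt (c : ℤ) : List Bool :=
  decide (c < 0) :: encNat c.natAbs

/-- The codes of the entries, each preceded by `true`, and a final `false`. -/
def encList {α : Type} (enc : α → List Bool) (l : List α) : List Bool :=
  l.flatMap (fun a => true :: enc a) ++ [false]

/-- The code of a pair is the concatenation of the codes of its components. -/
def encPair {α β : Type} (encα : α → List Bool) (encβ : β → List Bool) (a : α × β) : List Bool :=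
  encα a.1 ++ encβ a.2

/-- The code of a polynomial. -/
def Poly.encode (p : Poly) : List Bool :=
  encList (encPair encInt (encList (encPair encNat encNat))) p

/-- The code of a relation symbol. -/
def Rel.encode : Rel → List Bool
  | .lt => [false, false, false]
  | .le => [false, false, true]
  | .eq => [false, true, false]
  | .ge => [false, true, true]
  | .gt => [true, false, false]

/-- The code of a formula, in prefix notation. -/
def Formula.encode : Formula → List Bool
  | .atom R p => [false, false] ++ R.encode ++ p.encode
  | .not φ => [false, true] ++ φ.encode
  | .and φ ψ => [true, false] ++ φ.encode ++ ψ.encode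
  | .or φ ψ => [true, true] ++ φ.encode ++ ψ.encode

/-- The decision problem `ETR`: given a quantifier-free formula, do there exist real values of its
variables for which it holds? -/
def ETR : Language Bool :=
  {s | ∃ φ : Formula, φ.encode = s ∧ ∃ x : ℕ → ℝ, φ.Holds x}

/-- The class `∃ℝ`: the decision problems that reduce in polynomial time to `ETR`. -/
def ER : Set (Language Bool) :=
  {P | PolyTimeReducible P ETR}

/-! ### The encoding of formulas is injective -/

/-- A self-delimiting code: a code word can be recovered from any string that it begins. -/
def SelfDelimiting {α : Type} (enc : α → List Bool) : Prop :=
  ∀ a b s t, enc a ++ s = enc b ++ t → a = b ∧ s = t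

theorem encList_selfDelimiting {α : Type} {enc : α → List Bool} (h : SelfDelimiting enc) :
    SelfDelimiting (encList enc) := by
  intro a
  induction a with
  | nil =>
    intro b s t hst
    cases b with
    | nil => simpa [encList] using hst
    | cons b bs => simp [encList] at hst
  | cons a as ih =>
    intro b s t hst
    cases b with
    | nil => simp [encList] at hst
    | cons b bs =>
      simp only [encList, List.flatMap_cons, List.cons_append, List.append_assoc,
        List.cons.injEq, true_and] at hst
      obtain ⟨rfl, h2⟩ := h _ _ _ _ hst
      obtain ⟨rfl, h3⟩ := ih bs s t (by simpa [encList] using h2)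
      exact ⟨rfl, h3⟩

theorem encPair_selfDelimiting {α β : Type} {encα : α → List Bool} {encβ : β → List Bool}
    (hα : SelfDelimiting encα) (hβ : SelfDelimiting encβ) :
    SelfDelimiting (encPair encα encβ) := by
  rintro ⟨a, b⟩ ⟨a', b'⟩ s t hst
  simp only [encPair, List.append_assoc] at hst
  obtain ⟨rfl, h2⟩ := hα _ _ _ _ hst
  obtain ⟨rfl, h3⟩ := hβ _ _ _ _ h2
  exact ⟨rfl, h3⟩

theorem encNat_selfDelimiting : SelfDelimiting encNat := by
  intro a b s t hst
  have hb : SelfDelimiting (fun b : Bool => [b]) := by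
    intro a b s t h
    simpa using h
  obtain ⟨h1, h2⟩ := encList_selfDelimiting hb _ _ s t hst
  exact ⟨Computability.encodingNatBool.encode_injective h1, h2⟩

theorem encInt_selfDelimiting : SelfDelimiting encInt := by
  intro a b s t hst
  simp only [encInt, List.cons_append, List.cons.injEq, decide_eq_decide] at hst
  obtain ⟨h1, h2⟩ := hst
  obtain ⟨h3, h4⟩ := encNat_selfDelimiting _ _ _ _ h2
  exact ⟨by omega, h4⟩

theorem Poly.encode_selfDelimiting : SelfDelimiting Poly.encode :=
  encList_selfDelimiting (encPair_selfDelimiting encInt_selfDelimiting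
    (encList_selfDelimiting (encPair_selfDelimiting encNat_selfDelimiting encNat_selfDelimiting)))

theorem Rel.encode_selfDelimiting : SelfDelimiting Rel.encode := by
  intro a b s t hst
  cases a <;> cases b <;> simp_all [Rel.encode]

theorem Formula.encode_selfDelimiting : SelfDelimiting Formula.encode := by
  intro a
  induction a with
  | atom R p =>
    intro b s t hst
    cases b <;> simp [Formula.encode] at hst
    obtain ⟨rfl, h2⟩ := Rel.encode_selfDelimiting _ _ _ _ hst
    obtain ⟨rfl, h3⟩ := Poly.encode_selfDelimiting _ _ _ _ h2
    exact ⟨rfl, h3⟩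
  | not φ ih =>
    intro b s t hst
    cases b <;> simp [Formula.encode] at hst
    obtain ⟨rfl, h2⟩ := ih _ _ _ hst
    exact ⟨rfl, h2⟩
  | and φ ψ ih1 ih2 =>
    intro b s t hst
    cases b <;> simp [Formula.encode] at hst
    obtain ⟨rfl, h2⟩ := ih1 _ _ _ hst
    obtain ⟨rfl, h3⟩ := ih2 _ _ _ h2
    exact ⟨rfl, h3⟩
  | or φ ψ ih1 ih2 =>
    intro b s t hst
    cases b <;> simp [Formula.encode] at hst
    obtain ⟨rfl, h2⟩ := ih1 _ _ _ hst
    obtain ⟨rfl, h3⟩ := ih2 _ _ _ h2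
    exact ⟨rfl, h3⟩

theorem Formula.encode_injective : Function.Injective Formula.encode := by
  intro a b h
  exact (Formula.encode_selfDelimiting a b [] [] (by simpa using h)).1

end ExistsReal

/-! The run of a verifier is described by real numbers. A stack becomes one real: its symbols,
numbered below `b`, give the odd digits `2n + 1` of an expansion in base `2b`, and the empty stack
is 0. Pushing and popping are then affine maps with rational coefficients, and the gaps between odd
digits let inequalities read off the top symbol (`Coding.uncons_mem_iff`). So a machine step is a
relation between two real points, defined by a formula that depends on the machine only
(`Coding.result_iff`, `Coding.definable_next`).

The reduction prints a conjunction of copies of such formulas, one per time, with time running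
backwards. Index 0 is the end of the run and index `T` its start; indices from `T` to `T + |x|`
build the input by pushing the letters of `x`, and the `p` indices above these push an arbitrary bit
or nothing. Only those last steps leave a choice, namely the witness `w`; the codes of all later
configurations are forced. Hence the conjunction is satisfiable iff some `w` is accepted
(`Coding.exists_computation_iff`).

It remains to print this conjunction in polynomial time. The point at time `t` occupies the
variables `2 ^ t * (2 * j + 1)`, which are disjoint for different `t`. Replacing `xᵢ` by `x_{2 ^ t *
(i + 1)}` moves a formula to time `t`, and in binary this only puts `t` zeros before a fixed word,
so a unary counter is enough and no arithmetic is needed. The printing is done by structured stack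
programs, which compile to Turing machines (`Prog.polyTimeFun`, `polyTimeFun_computation`). -/

namespace ExistsReal

open Turing Function

/-! ### A small language of stack programs -/

/-- The stacks of the programs below. -/
inductive Stk : Type
  | inp
  | inp'
  | tok
  | tok'
  | ctr
  | ctr'
  | out
  deriving DecidableEq

instance : Fintype Stk :=
  ⟨{.inp, .inp', .tok, .tok', .ctr, .ctr', .out}, fun k => by cases k <;> decide⟩

/-- Programs acting on the stacks `Stk`, whose entries are bits. The program `loop k body` pops
entries from the stack `k` until it is empty, and runs `body a` for each popped entry `a`. -/
inductive Prog : Type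
  | push (k : Stk) (a : Bool)
  | seq (p q : Prog)
  | loop (k : Stk) (body : Bool → Prog)

/-- `Exec p S S' t` says that `p` transforms the stacks `S` into `S'` in `t` steps. -/
inductive Exec : Prog → (Stk → List Bool) → (Stk → List Bool) → ℕ → Prop
  | push (k a S) : Exec (.push k a) S (update S k (a :: S k)) 1
  | seq {p q S₁ S₂ S₃ t₁ t₂} : Exec p S₁ S₂ t₁ → Exec q S₂ S₃ t₂ →
      Exec (.seq p q) S₁ S₃ (t₂ + t₁)
  | loop_nil {k b S} : S k = [] → Exec (.loop k b) S S 1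
  | loop_cons {k b S S₁ S₂ a l t₁ t₂} : S k = a :: l → Exec (b a) (update S k l) S₁ t₁ →
      Exec (.loop k b) S₁ S₂ t₂ → Exec (.loop k b) S S₂ (t₂ + (t₁ + 1))

/-- The labels of the Turing machine for a program. -/
inductive Prog.Label : Prog → Type
  | push {k a} : Label (.push k a)
  | left {p q} : p.Label → Label (.seq p q)
  | right {p q} : q.Label → Label (.seq p q)
  | test {k b} : Label (.loop k b)
  | body {k b} (a : Bool) : (b a).Label → Label (.loop k b)

/-- The label at which a program starts. -/
def Prog.entry : (p : Prog) → p.Label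
  | .push _ _ => .push
  | .seq p _ => .left p.entry
  | .loop _ _ => .test

instance Prog.finite_label (p : Prog) : Finite p.Label := by
  induction p with
  | push k a => exact .of_surjective (fun _ : Unit => .push) fun | .push => ⟨(), rfl⟩
  | seq p q =>
    exact .of_surjective (Sum.elim .left .right : p.Label ⊕ q.Label → _) fun
      | .left l => ⟨.inl l, rfl⟩
      | .right l => ⟨.inr l, rfl⟩
  | loop k b =>
    exact .of_surjective (fun | none => .test | some ⟨a, l⟩ => .body a l :
      Option (Σ a, (b a).Label) → _) fun
      | .test => ⟨none, rfl⟩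
      | .body a l => ⟨some ⟨a, l⟩, rfl⟩

noncomputable instance (p : Prog) : Fintype p.Label := .ofFinite _

/-- The code of a program whose labels are embedded by `e` into those of a machine, and which
continues at the label `exit`. -/
def Prog.code {Λ : Type} : {p : Prog} → (p.Label → Λ) → Λ → p.Label →
    TM2.Stmt (fun _ : Stk => Bool) Λ (Option Bool)
  | .push k a, _, exit, .push => .push k (fun _ => a) (.goto fun _ => exit)
  | .seq _ q, e, _, .left l => code (fun l => e (.left l)) (e (.right q.entry)) l
  | .seq _ _, e, exit, .right l => code (fun l => e (.right l)) exit l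
  | .loop k b, e, exit, .test => .pop k (fun _ a => a)
      (.goto fun v => v.elim exit fun a => e (.body a (b a).entry))
  | .loop _ _, e, _, .body a l => code (fun l => e (.body a l)) (e .test) l

/-- The costs in `Exec` are exact machine step counts: a push or a loop test is one statement, and
sequencing is free. The embedding `e` and the exit label are arbitrary so that the induction applies
to subprograms inside a larger machine. -/
theorem Prog.code_evalsTo {Λ : Type} {m : Λ → TM2.Stmt (fun _ : Stk => Bool) Λ (Option Bool)}
    {p : Prog} {S S' : Stk → List Bool} {t : ℕ} (h : Exec p S S' t) :
    ∀ (e : p.Label → Λ) (exit : Λ), (∀ l, m (e l) = code e exit l) → ∀ v, ∃ v',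
      (flip bind (TM2.step m))^[t] (some ⟨some (e p.entry), v, S⟩) =
        some ⟨some exit, v', S'⟩ := by
  induction h with
  | push k a S =>
    intro e exit hm v
    refine ⟨v, ?_⟩
    simp [flip, Prog.entry, hm, Prog.code]
  | seq _ _ ih₁ ih₂ =>
    intro e exit hm v
    obtain ⟨v₁, h₁⟩ := ih₁ (fun l => e (.left l)) _ (fun l => by rw [hm, Prog.code]) v
    obtain ⟨v₂, h₂⟩ := ih₂ (fun l => e (.right l)) exit (fun l => by rw [hm, Prog.code]) v₁
    exact ⟨v₂, by rw [iterate_add_apply, ← h₂, ← h₁, Prog.entry]⟩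
  | loop_nil hk =>
    intro e exit hm v
    refine ⟨none, ?_⟩
    simp only [iterate_one, flip, Option.bind_eq_bind, Option.bind_some, Prog.entry, TM2.step, hm,
      Prog.code, TM2.stepAux, hk, List.head?_nil, Option.elim_none, List.tail_nil]
    rw [← hk, update_eq_self]
  | @loop_cons _ b _ _ _ a _ _ _ hk _ _ ih₁ ih₂ =>
    intro e exit hm v
    obtain ⟨v₁, h₁⟩ := ih₁ (fun l => e (.body a l)) _ (fun l => by rw [hm, Prog.code]) (some a)
    obtain ⟨v₂, h₂⟩ := ih₂ e exit hm v₁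
    refine ⟨v₂, ?_⟩
    rw [iterate_add_apply, iterate_succ_apply, ← h₂]
    congr 1
    simp only [Prog.entry, ← h₁]
    simp [flip, hm, Prog.code, hk]

/-- The Turing machine that runs a program. -/
noncomputable def Prog.machine (p : Prog) : FinTM2 where
  K := Stk
  k₀ := .inp
  k₁ := .out
  Γ _ := Bool
  Γk₀Fin := inferInstanceAs (Fintype Bool)
  Λ := Option p.Label
  main := some p.entry
  σ := Option Bool
  initialState := none
  m
    | some l => Prog.code some none l
    | none => .load (fun _ => none) .halt

theorem Prog.polyTimeFun (p : Prog) (f : List Bool → List Bool) (T : Polynomial ℕ)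
    (h : ∀ x, ∃ t ≤ T.eval x.length,
      Exec p (update (fun _ => []) .inp x) (update (fun _ => []) .out (f x)) t) :
    PolyTimeFun f := by
  choose t ht hp using h
  -- The extra step is the one at the label `none`: it resets the internal state, as `haltList`
  -- demands, and halts.
  refine ⟨⟨⟨p.machine, Equiv.refl _, Equiv.refl _⟩, T + 1, fun x => ⟨⟨t x + 1, ?_⟩, ?_⟩⟩⟩
  · obtain ⟨v, hv⟩ := Prog.code_evalsTo (m := p.machine.m) (hp x) some none (fun _ => rfl) none
    have hid (l : List Bool) : l.map (Equiv.refl Bool).invFun = l := List.map_id l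
    have h₁ : initList p.machine (x.map (Equiv.refl Bool).invFun) =
        ⟨some (some p.entry), none, update (fun _ => []) .inp x⟩ := by
      refine (congrArg (initList p.machine) (hid x)).trans ?_
      exact congrArg (TM2.Cfg.mk _ _) (funext fun k => by cases k <;> rfl)
    have h₂ : haltList p.machine ((f x).map (Equiv.refl Bool).invFun) =
        ⟨none, none, update (fun _ => []) .out (f x)⟩ := by
      refine (congrArg (haltList p.machine) (hid (f x))).trans ?_
      exact congrArg (TM2.Cfg.mk _ _) (funext fun k => by cases k <;> rfl)
    rw [iterate_succ_apply']
    refine (congrArg (flip bind (TM2.step p.machine.m))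
      ((congrArg _ (congrArg some h₁)).trans hv)).trans ?_
    refine Eq.trans ?_ (congrArg some h₂.symm)
    rfl
  · simpa [Computability.encodingList] using ht x

/-! ### Running stack programs within a time bound -/

/-- `ExecLE p S S' T` says that `p` transforms the stacks `S` into `S'` in at most `T` steps. -/
def ExecLE (p : Prog) (S S' : Stk → List Bool) (T : ℕ) : Prop :=
  ∃ t ≤ T, Exec p S S' t

/-- The stacks with given contents. -/
def tapes (i i' k k' c c' o : List Bool) : Stk → List Bool
  | .inp => i
  | .inp' => i'
  | .tok => k
  | .tok' => k'
  | .ctr => c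
  | .ctr' => c'
  | .out => o

section update

variable {i i' k k' c c' o l : List Bool}

@[simp] theorem update_tapes_inp :
    update (tapes i i' k k' c c' o) .inp l = tapes l i' k k' c c' o := by
  ext1 s; cases s <;> rfl

@[simp] theorem update_tapes_inp' :
    update (tapes i i' k k' c c' o) .inp' l = tapes i l k k' c c' o := by
  ext1 s; cases s <;> rfl

@[simp] theorem update_tapes_tok :
    update (tapes i i' k k' c c' o) .tok l = tapes i i' l k' c c' o := by
  ext1 s; cases s <;> rfl

@[simp] theorem update_tapes_tok' :
    update (tapes i i' k k' c c' o) .tok' l = tapes i i' k l c c' o := by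
  ext1 s; cases s <;> rfl

@[simp] theorem update_tapes_ctr :
    update (tapes i i' k k' c c' o) .ctr l = tapes i i' k k' l c' o := by
  ext1 s; cases s <;> rfl

@[simp] theorem update_tapes_ctr' :
    update (tapes i i' k k' c c' o) .ctr' l = tapes i i' k k' c l o := by
  ext1 s; cases s <;> rfl

@[simp] theorem update_tapes_out :
    update (tapes i i' k k' c c' o) .out l = tapes i i' k k' c c' l := by
  ext1 s; cases s <;> rfl

end update

namespace ExecLE

variable {p q : Prog} {k : Stk} {b : Bool → Prog} {a : Bool} {l : List Bool}
  {S S₁ S₂ S₃ : Stk → List Bool} {T T₁ T₂ : ℕ}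

theorem mono (h : ExecLE p S S₁ T₁) (hT : T₁ ≤ T₂) : ExecLE p S S₁ T₂ :=
  let ⟨t, ht, h⟩ := h
  ⟨t, ht.trans hT, h⟩

theorem push (h : update S k (a :: S k) = S₁) : ExecLE (.push k a) S S₁ 1 :=
  ⟨1, le_rfl, h ▸ .push k a S⟩

theorem seq (h₁ : ExecLE p S₁ S₂ T₁) (h₂ : ExecLE q S₂ S₃ T₂) :
    ExecLE (.seq p q) S₁ S₃ (T₁ + T₂) :=
  let ⟨t₁, ht₁, h₁⟩ := h₁
  let ⟨t₂, ht₂, h₂⟩ := h₂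
  ⟨t₂ + t₁, by omega, .seq h₁ h₂⟩

theorem loop_nil (h : S k = []) : ExecLE (.loop k b) S S 1 :=
  ⟨1, le_rfl, .loop_nil h⟩

theorem loop_cons (h : S k = a :: l) (h₁ : ExecLE (b a) (update S k l) S₁ T₁)
    (h₂ : ExecLE (.loop k b) S₁ S₂ T₂) : ExecLE (.loop k b) S S₂ (T₁ + T₂ + 1) :=
  let ⟨t₁, ht₁, h₁⟩ := h₁
  let ⟨t₂, ht₂, h₂⟩ := h₂
  ⟨t₂ + (t₁ + 1), by omega, .loop_cons h h₁ h₂⟩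

end ExecLE

/-- The word `1ⁿ`. -/
abbrev ones (n : ℕ) : List Bool := List.replicate n true

/-- The program that does nothing, provided that the auxiliary counter is empty. -/
def Prog.skip : Prog := .loop .ctr' (.push .ctr')

theorem ExecLE.skip {i i' k k' c o : List Bool} :
    ExecLE .skip (tapes i i' k k' c [] o) (tapes i i' k k' c [] o) 1 :=
  .loop_nil rfl

/-! ### Computing a polynomial in unary -/

theorem exec_inp_restore {i' k k' c c' o : List Bool} : ∀ {i : List Bool},
    ExecLE (.loop .inp' (.push .inp)) (tapes i i' k k' c c' o)
      (tapes (i'.reverse ++ i) [] k k' c c' o) (2 * i'.length + 1) := by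
  induction i' with
  | nil => exact .loop_nil rfl
  | cons a i' ih =>
    intro i
    have h := ih (i := a :: i)
    rw [show i'.reverse ++ a :: i = (a :: i').reverse ++ i by simp] at h
    refine (ExecLE.loop_cons rfl (ExecLE.push ?_) h).mono ?_
    · simp [tapes]
    · simp; omega

theorem exec_inp_copy {i k c c' o : List Bool} : ∀ {i' : List Bool} {n : ℕ},
    ExecLE (.loop .inp fun a => .seq (.push .inp' a) (.push .tok' true))
      (tapes i i' k (ones n) c c' o)
      (tapes [] (i.reverse ++ i') k (ones (i.length + n)) c c' o) (3 * i.length + 1) := by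
  induction i with
  | nil => intro i' n; simpa using ExecLE.loop_nil rfl
  | cons a i ih =>
    intro i' n
    have h := ih (i' := a :: i') (n := n + 1)
    rw [show i.length + (n + 1) = (a :: i).length + n by simp; omega,
      show i.reverse ++ a :: i' = (a :: i).reverse ++ i' by simp] at h
    refine (ExecLE.loop_cons rfl (ExecLE.seq (ExecLE.push rfl) (ExecLE.push ?_)) h).mono ?_
    · simp [tapes, List.replicate_succ]
    · simp; omega

theorem exec_tok_move {i i' c c' o : List Bool} {n : ℕ} : ∀ {m : ℕ},
    ExecLE (.loop .tok' (.push .tok)) (tapes i i' (ones m) (ones n) c c' o)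
      (tapes i i' (ones (n + m)) [] c c' o) (2 * n + 1) := by
  induction n with
  | zero => intro m; simpa using ExecLE.loop_nil rfl
  | succ n ih =>
    intro m
    have h := ih (m := m + 1)
    rw [show n + (m + 1) = n + 1 + m by omega] at h
    refine (ExecLE.loop_cons rfl (ExecLE.push ?_) h).mono ?_
    · simp [tapes, List.replicate_succ]
    · omega

/-- The program that multiplies the number of tokens by the length of the input. -/
def Prog.mulTok : Prog :=
  .loop .tok fun _ => .seq (.loop .inp fun a => .seq (.push .inp' a) (.push .tok' true))
    (.loop .inp' (.push .inp))

theorem exec_tok_mul {i c c' o : List Bool} {m : ℕ} : ∀ {n : ℕ},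
    ExecLE .mulTok (tapes i [] (ones m) (ones n) c c' o)
      (tapes i [] [] (ones (m * i.length + n)) c c' o) (m * (5 * i.length + 3) + 1) := by
  induction m with
  | zero => intro n; simpa [Prog.mulTok] using ExecLE.loop_nil rfl
  | succ m ih =>
    intro n
    have h₁ := exec_inp_copy (i := i) (i' := []) (n := n) (k := ones m) (c := c) (c' := c') (o := o)
    have h₂ := exec_inp_restore (i' := i.reverse) (i := []) (k := ones m)
      (k' := ones (i.length + n)) (c := c) (c' := c') (o := o)
    have h := ih (n := i.length + n)
    simp only [List.append_nil, List.reverse_reverse, List.length_reverse] at h₁ h₂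
    rw [← add_assoc, ← add_one_mul] at h
    refine (ExecLE.loop_cons rfl (ExecLE.seq (T₁ := 3 * i.length + 1) ?_ h₂) h).mono ?_
    · simpa using h₁
    · linarith

/-- Horner's scheme needs only two operations on the number of tokens: adding one, and multiplying
by the input length, which is one pass over the input per token. -/
theorem exec_unary_polynomial (p : Polynomial ℕ) : ∃ (P : Prog) (T : Polynomial ℕ),
    ∀ i c o, ExecLE P (tapes i [] [] [] c [] o)
      (tapes i [] (ones (p.eval i.length)) [] c [] o) (T.eval i.length) := by
  induction p using Polynomial.recOnHorner with
  | M0 => exact ⟨.skip, 1, fun i c o => by simpa using ExecLE.skip⟩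
  | MC p a _ _ ih =>
    -- Without this, the side condition `a ≠ 0` would enter the induction on `a`.
    clear * - ih
    induction a with
    | zero => simpa using ih
    | succ a ih =>
      obtain ⟨P, T, h⟩ := ih
      refine ⟨.seq P (.push .tok true), T + 1, fun i c o => ?_⟩
      simpa using (h i c o).seq (ExecLE.push (k := .tok) (a := true)
        (by simp [tapes, ← List.replicate_succ, add_assoc]))
  | MX p _ ih =>
    obtain ⟨P, T, h⟩ := ih
    have hmul (i c o : List Bool) := (h i c o).seq
      ((exec_tok_mul (n := 0)).seq (exec_tok_move (m := 0)))
    refine ⟨.seq P (.seq .mulTok (.loop .tok' (.push .tok))),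
      T + ((p * (5 * .X + 3) + 1) + (2 * (p * .X) + 1)), fun i c o =>
      cast (by simp) (hmul i c o)⟩

/-! ### Printing formulas whose variables depend on a unary counter -/

/-- The polynomial obtained by replacing each variable `xᵢ` by `x_{2ᵗ(i+1)}`. -/
def Poly.shift (t : ℕ) (p : Poly) : Poly :=
  p.map fun m => (m.1, m.2.map fun v => (2 ^ t * (v.1 + 1), v.2))

/-- The formula obtained by replacing each variable `xᵢ` by `x_{2ᵗ(i+1)}`. -/
def Formula.shift (t : ℕ) : Formula → Formula
  | .atom R p => .atom R (p.shift t)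
  | .not φ => .not (φ.shift t)
  | .and φ ψ => .and (φ.shift t) (ψ.shift t)
  | .or φ ψ => .or (φ.shift t) (ψ.shift t)

theorem Poly.eval_shift (t : ℕ) (p : Poly) (x : ℕ → ℝ) :
    (p.shift t).eval x = p.eval fun i => x (2 ^ t * (i + 1)) := by
  simp [Poly.shift, Poly.eval, comp_def]

theorem Formula.holds_shift (t : ℕ) (φ : Formula) (x : ℕ → ℝ) :
    (φ.shift t).Holds x ↔ φ.Holds fun i => x (2 ^ t * (i + 1)) := by
  induction φ <;> simp_all [Formula.shift, Formula.Holds, Poly.eval_shift]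

/-- Digits are listed from the least significant one. Zero is excluded because its code is empty;
this is why shifted indices use `i + 1`. -/
theorem encodeNat_two_mul {n : ℕ} (hn : n ≠ 0) :
    Computability.encodeNat (2 * n) = false :: Computability.encodeNat n := by
  have h : ((2 * n : ℕ) : Num) = Num.bit0 n := by
    rw [two_mul, Nat.cast_add, Num.bit0_of_bit0]
  have hn' : (n : Num) ≠ 0 := by simpa using hn
  rw [Computability.encodeNat, Computability.encodeNat, h]
  generalize (n : Num) = m at hn'
  cases m with
  | zero => exact absurd rfl hn'
  | pos m => rfl

theorem encodeNat_two_pow_mul (t : ℕ) {n : ℕ} (hn : n ≠ 0) :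
    Computability.encodeNat (2 ^ t * n) =
      List.replicate t false ++ Computability.encodeNat n := by
  induction t with
  | zero => simp
  | succ t ih =>
    rw [pow_succ', mul_assoc, encodeNat_two_mul (by positivity), ih, List.replicate_succ,
      List.cons_append]

/-- The function `f` is printed by a program that finds its argument on the unary counter. -/
def Printable (f : ℕ → List Bool) : Prop :=
  ∃ (p : Prog) (a : ℕ), ∀ t i i' k k' o,
    ExecLE p (tapes i i' k k' (ones t) [] o) (tapes i i' k k' (ones t) [] (f t ++ o)) (a * (t + 1))

namespace Printable

/-- The output is a stack, so the right part is printed first. -/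
theorem append {f g : ℕ → List Bool} (hf : Printable f) (hg : Printable g) :
    Printable fun t => f t ++ g t := by
  obtain ⟨p, a, hp⟩ := hf
  obtain ⟨q, b, hq⟩ := hg
  refine ⟨.seq q p, b + a, fun t i i' k k' o => ?_⟩
  rw [add_mul, List.append_assoc]
  exact (hq t i i' k k' o).seq (hp t i i' k k' _)

theorem const (l : List Bool) : Printable fun _ => l := by
  induction l with
  | nil => exact ⟨.skip, 1, fun t i i' k k' o => ExecLE.skip.mono (by omega)⟩
  | cons b l ih =>
    exact append (f := fun _ => [b]) ⟨.push .out b, 1, fun t i i' k k' o =>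
      (ExecLE.push (by simp [tapes])).mono (by omega)⟩ ih

theorem zeros : Printable fun t => (List.replicate t false).flatMap fun b => [true, b] := by
  have h₁ (i i' k k' : List Bool) (t : ℕ) : ∀ (s : ℕ) (o : List Bool),
      ExecLE (.loop .ctr fun _ => .seq (.push .out false) (.seq (.push .out true)
          (.push .ctr' true)))
        (tapes i i' k k' (ones t) (ones s) o)
        (tapes i i' k k' [] (ones (t + s))
          ((List.replicate t false).flatMap (fun b => [true, b]) ++ o)) (4 * t + 1) := by
    induction t with
    | zero => intro s o; simpa using ExecLE.loop_nil rfl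
    | succ t ih =>
      intro s o
      have h := ih (s + 1) ([true, false] ++ o)
      rw [← List.append_assoc, show (List.replicate t false).flatMap (fun b => [true, b]) ++
        [true, false] = (List.replicate (t + 1) false).flatMap (fun b => [true, b]) by
          simp [List.replicate_succ'], show t + (s + 1) = t + 1 + s by omega] at h
      refine (ExecLE.loop_cons rfl (ExecLE.seq (ExecLE.push rfl) (ExecLE.seq (ExecLE.push rfl)
        (ExecLE.push ?_))) h).mono ?_
      · simp [tapes, List.replicate_succ]
      · omega
  have h₂ (i i' k k' o : List Bool) (t : ℕ) : ∀ s : ℕ,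
      ExecLE (.loop .ctr' (.push .ctr)) (tapes i i' k k' (ones s) (ones t) o)
        (tapes i i' k k' (ones (t + s)) [] o) (2 * t + 1) := by
    induction t with
    | zero => intro s; simpa using ExecLE.loop_nil rfl
    | succ t ih =>
      intro s
      have h := ih (s + 1)
      rw [show t + (s + 1) = t + 1 + s by omega] at h
      refine (ExecLE.loop_cons rfl (ExecLE.push ?_) h).mono ?_
      · simp [tapes, List.replicate_succ]
      · omega
  exact ⟨_, 6, fun t i i' k k' o =>
    ((h₁ i i' k k' t 0 o).seq (h₂ i i' k k' _ t 0)).mono (by omega)⟩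

theorem encNat_index (i : ℕ) : Printable fun t => encNat (2 ^ t * (i + 1)) := by
  simpa [encNat, encodeNat_two_pow_mul] using zeros.append (const (encNat (i + 1)))

theorem list {α β : Type} (enc : β → List Bool) (g : ℕ → α → β) (l : List α)
    (h : ∀ a, Printable fun t => enc (g t a)) :
    Printable fun t => encList enc (l.map (g t)) := by
  induction l with
  | nil => exact const [false]
  | cons a l ih =>
    simpa [encList] using (const [true]).append ((h a).append ih)

theorem poly (p : Poly) : Printable fun t => (p.shift t).encode :=
  list _ _ p fun m => (const (encInt m.1)).append
    (list _ _ m.2 fun v => (encNat_index v.1).append (const (encNat v.2)))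

theorem formula (φ : Formula) : Printable fun t => (φ.shift t).encode := by
  induction φ with
  | atom R p => exact (const _).append (poly p)
  | not φ ih => exact (const _).append ih
  | and φ ψ ihφ ihψ => exact ((const [true, false]).append ihφ).append ihψ
  | or φ ψ ihφ ihψ => exact ((const [true, true]).append ihφ).append ihψ

end Printable

/-! ### Printing long conjunctions -/

/-- The conjunction of `φ` and the shifts of the entries of `L` by `t`, `t + 1`, … -/
def Formula.chain : ℕ → Formula → List Formula → Formula
  | _, φ, [] => φ
  | t, φ, ψ :: L => chain (t + 1) (.and (ψ.shift t) φ) L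

theorem Formula.chain_append (t : ℕ) (φ : Formula) (L L' : List Formula) :
    Formula.chain t φ (L ++ L') = Formula.chain (t + L.length) (Formula.chain t φ L) L' := by
  induction L generalizing t φ with
  | nil => rfl
  | cons ψ L ih => simp [Formula.chain, ih, add_assoc, add_comm 1]

theorem Formula.holds_chain (t : ℕ) (φ : Formula) (L : List Formula) (x : ℕ → ℝ) :
    (Formula.chain t φ L).Holds x ↔
      φ.Holds x ∧ ∀ n (h : n < L.length), (L[n].shift (t + n)).Holds x := by
  induction L generalizing t φ with
  | nil => simp [Formula.chain]
  | cons ψ L ih =>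
    rw [Formula.chain, ih, Formula.Holds, and_comm (a := (ψ.shift t).Holds x), and_assoc,
      and_congr_right_iff]
    intro _
    constructor
    · rintro ⟨h₀, h⟩ (_ | n) hn
      · exact h₀
      · simpa [add_assoc, add_comm 1] using h n (by simpa using hn)
    · intro h
      refine ⟨h 0 (by simp), fun n hn => ?_⟩
      have := h (n + 1) (by simpa using hn)
      rwa [← add_assoc, add_right_comm] at this

/-- In prefix notation a conjunct is added by pushing symbols on top of the finished code of `φ`,
which need not be read again. -/
theorem exec_conj (ψ : Formula) : ∃ (P : Prog) (a : ℕ), ∀ t i i' k k' φ,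
    ExecLE P (tapes i i' k k' (ones t) [] (Formula.encode φ))
      (tapes i i' k k' (ones (t + 1)) [] (Formula.encode (.and (ψ.shift t) φ)))
      (a * (t + 1)) := by
  obtain ⟨P, a, h⟩ := (Printable.const [true, false]).append (Printable.formula ψ)
  refine ⟨.seq P (.push .ctr true), a + 1, fun t i i' k k' φ =>
    ((h t i i' k k' _).seq (ExecLE.push ?_)).mono (by linarith)⟩
  simp [tapes, List.replicate_succ, Formula.encode]

theorem exec_conj_tok (ψ : Formula) : ∃ (P : Prog) (a : ℕ), ∀ n t i i' k' φ,
    ExecLE P (tapes i i' (ones n) k' (ones t) [] (Formula.encode φ))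
      (tapes i i' [] k' (ones (t + n)) []
        (Formula.encode (.chain t φ (List.replicate n ψ))))
      (a * (n + 1) * (t + n + 1)) := by
  obtain ⟨P, a, h⟩ := exec_conj ψ
  refine ⟨.loop .tok fun _ => P, a + 1, fun n t i i' k' φ => ?_⟩
  induction n generalizing t φ with
  | zero => exact (ExecLE.loop_nil rfl).mono (by nlinarith)
  | succ n ih =>
    have h₂ := ih (t + 1) (.and (ψ.shift t) φ)
    rw [show t + 1 + n = t + (n + 1) by omega] at h₂
    refine (ExecLE.loop_cons rfl (T₁ := a * (t + 1)) ?_ h₂).mono (by nlinarith)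
    simpa using h t i i' (ones n) k' φ

/-- Letters come off the stack first letter first, so the first one gets the smallest index. Since
time runs backwards, it is the last to be pushed in the coded computation and ends on top. -/
theorem exec_conj_inp (ψ : Bool → Formula) : ∃ (P : Prog) (a : ℕ), ∀ i t i' k k' φ,
    ExecLE P (tapes i i' k k' (ones t) [] (Formula.encode φ))
      (tapes [] (i.reverse ++ i') k k' (ones (t + i.length)) []
        (Formula.encode (.chain t φ (i.map ψ))))
      (a * (i.length + 1) * (t + i.length + 1)) := by
  choose P a h using fun b => exec_conj (ψ b)
  have ha (b : Bool) : a b ≤ a false + a true := by cases b <;> omega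
  refine ⟨.loop .inp fun b => .seq (P b) (.push .inp' b), a false + a true + 2,
    fun i t i' k k' φ => ?_⟩
  induction i generalizing t i' φ with
  | nil => exact (ExecLE.loop_nil rfl).mono (by simp; nlinarith)
  | cons b i ih =>
    have h₂ := ih (t + 1) (b :: i') (.and ((ψ b).shift t) φ)
    rw [show t + 1 + i.length = t + (b :: i).length by simp; omega,
      show i.reverse ++ b :: i' = (b :: i).reverse ++ i' by simp] at h₂
    have h₁ := (h b t i i' k k' φ).mono (Nat.mul_le_mul_right _ (ha b))
    refine (ExecLE.loop_cons rfl (T₁ := (a false + a true) * (t + 1) + 1)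
      ?_ h₂).mono ?_
    · rw [update_tapes_inp]
      exact h₁.seq (ExecLE.push (k := .inp') (a := b) update_tapes_inp')
    · simp only [List.length_cons]
      nlinarith

/-- A halting configuration in the sense of `haltList` has every stack except the output empty, so
leftovers must be removed. -/
theorem exec_clear_inp {i' k k' c o : List Bool} : ∀ {i : List Bool},
    ExecLE (.loop .inp fun _ => .skip) (tapes i i' k k' c [] o)
      (tapes [] i' k k' c [] o) (2 * i.length + 1) := by
  intro i
  induction i with
  | nil => exact .loop_nil rfl
  | cons a i ih =>
    refine (ExecLE.loop_cons rfl (T₁ := 1) ?_ ih).mono (by simp; omega)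
    simpa using ExecLE.skip

theorem exec_clear_ctr {i i' k k' c o : List Bool} :
    ExecLE (.loop .ctr fun _ => .skip) (tapes i i' k k' c [] o)
      (tapes i i' k k' [] [] o) (2 * c.length + 1) := by
  induction c with
  | nil => exact .loop_nil rfl
  | cons a i ih =>
    refine (ExecLE.loop_cons rfl (T₁ := 1) ?_ ih).mono (by simp; omega)
    simpa using ExecLE.skip

theorem tapes_input (x : List Bool) :
    tapes x [] [] [] [] [] [] = update (fun _ => []) .inp x := by
  ext1 s; cases s <;> rfl

theorem tapes_output (x : List Bool) :
    tapes [] [] [] [] [] [] x = update (fun _ => []) .out x := by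
  ext1 s; cases s <;> rfl

/-- The conjunction of `acc` at the time `0`, of `run` at the next `T` times, of the formulas
`inp b` for the letters `b` of the input, of `guess` at the next `p` times, and of `init`. -/
def Formula.computation (acc run guess init : Formula) (inp : Bool → Formula) (T p : ℕ)
    (x : List Bool) : Formula :=
  .and (init.shift (T + x.length + p))
    (.chain 0 (acc.shift 0) (List.replicate T run ++ x.map inp ++ List.replicate p guess))

theorem polyTimeFun_computation (acc run guess init : Formula) (inp : Bool → Formula)
    (T p : Polynomial ℕ) :
    PolyTimeFun fun x =>
      (Formula.computation acc run guess init inp (T.eval x.length) (p.eval x.length) x).encode := by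
  obtain ⟨P₁, a₁, h₁⟩ := Printable.formula acc
  obtain ⟨P₂, T₂, h₂⟩ := exec_unary_polynomial T
  obtain ⟨P₃, a₃, h₃⟩ := exec_conj_tok run
  obtain ⟨P₄, a₄, h₄⟩ := exec_conj_inp inp
  obtain ⟨P₅, T₅, h₅⟩ := exec_unary_polynomial p
  obtain ⟨P₆, a₆, h₆⟩ := exec_conj_tok guess
  obtain ⟨P₇, a₇, h₇⟩ := exec_conj init
  refine Prog.polyTimeFun
    (.seq P₁ <| .seq P₂ <| .seq P₃ <| .seq P₄ <| .seq (.loop .inp' (.push .inp)) <| .seq P₅ <|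
      .seq P₆ <| .seq P₇ <| .seq (.loop .inp fun _ => .skip) (.loop .ctr fun _ => .skip)) _
    (.C a₁ + (T₂ + (.C a₃ * (T + 1) * (T + 1) + (.C a₄ * (.X + 1) * (T + .X + 1) +
      ((2 * .X + 1) + (T₅ + (.C a₆ * (p + 1) * (T + .X + p + 1) + (.C a₇ * (T + .X + p + 1) +
        ((2 * .X + 1) + (2 * (T + .X + p + 1) + 1)))))))))) fun x => ?_
  rw [← tapes_input, ← tapes_output, Formula.computation, Formula.chain_append,
    Formula.chain_append]
  simp only [List.length_append, List.length_replicate, List.length_map, zero_add]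
  have e₁ := h₁ 0 x [] [] [] []
  have e₂ := h₂ x [] (Formula.encode (acc.shift 0))
  have e₃ := h₃ (T.eval x.length) 0 x [] [] (acc.shift 0)
  have e₄ := h₄ x (T.eval x.length) [] [] []
    (.chain 0 (acc.shift 0) (List.replicate (T.eval x.length) run))
  -- The input is put back because `p` is still to be evaluated at its length.
  have e₅ := exec_inp_restore (i' := x.reverse) (i := []) (k := []) (k' := [])
    (c := ones (T.eval x.length + x.length)) (c' := [])
    (o := Formula.encode (.chain (T.eval x.length)
      (.chain 0 (acc.shift 0) (List.replicate (T.eval x.length) run)) (x.map inp)))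
  have e₆ := h₅ x (ones (T.eval x.length + x.length)) (Formula.encode (.chain (T.eval x.length)
      (.chain 0 (acc.shift 0) (List.replicate (T.eval x.length) run)) (x.map inp)))
  have e₇ := h₆ (p.eval x.length) (T.eval x.length + x.length) x [] [] (.chain (T.eval x.length)
      (.chain 0 (acc.shift 0) (List.replicate (T.eval x.length) run)) (x.map inp))
  have e₈ := h₇ (T.eval x.length + x.length + p.eval x.length) x [] [] []
    (.chain (T.eval x.length + x.length) (.chain (T.eval x.length)
      (.chain 0 (acc.shift 0) (List.replicate (T.eval x.length) run)) (x.map inp))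
        (List.replicate (p.eval x.length) guess))
  simp only [List.replicate_zero, List.append_nil, zero_add, List.reverse_reverse, mul_one,
    List.length_reverse] at e₁ e₃ e₄ e₅
  have e := e₁.seq (e₂.seq (e₃.seq (e₄.seq (e₅.seq (e₆.seq (e₇.seq (e₈.seq
    (exec_clear_inp.seq exec_clear_ctr))))))))
  simpa [ExecLE] using e

/-! ### Definable sets of real points -/

/-- Some positive integer multiple of `f` is a polynomial with integer coefficients. -/
def RatPoly (f : (ℕ → ℝ) → ℝ) : Prop :=
  ∃ (c : ℕ) (p : Poly), 0 < c ∧ ∀ x, p.eval x = c * f x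

namespace RatPoly

theorem var (i : ℕ) : RatPoly fun x => x i :=
  ⟨1, [(1, [(i, 1)])], one_pos, fun x => by simp [Poly.eval]⟩

theorem natCast (n : ℕ) : RatPoly fun _ => n :=
  ⟨1, [(n, [])], one_pos, fun x => by simp [Poly.eval]⟩

theorem linear (a b : ℤ) {f g : (ℕ → ℝ) → ℝ} (hf : RatPoly f) (hg : RatPoly g) :
    RatPoly fun x => a * f x + b * g x := by
  obtain ⟨c, p, hc, hp⟩ := hf
  obtain ⟨d, q, hd, hq⟩ := hg
  have smul (k : ℤ) (r : Poly) (x : ℕ → ℝ) :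
      Poly.eval x (r.map fun m => (k * m.1, m.2)) = k * r.eval x := by
    simp [Poly.eval, ← List.sum_map_mul_left, mul_assoc, comp_def]
  have add (r s : Poly) (x : ℕ → ℝ) : Poly.eval x (r ++ s) = r.eval x + s.eval x := by
    simp [Poly.eval]
  refine ⟨c * d, p.map (fun m => (a * d * m.1, m.2)) ++ q.map (fun m => (b * c * m.1, m.2)),
    Nat.mul_pos hc hd, fun x => ?_⟩
  rw [add, smul, smul, hp, hq]
  push_cast
  ring

theorem add {f g : (ℕ → ℝ) → ℝ} (hf : RatPoly f) (hg : RatPoly g) :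
    RatPoly fun x => f x + g x := by
  simpa using linear 1 1 hf hg

theorem sub {f g : (ℕ → ℝ) → ℝ} (hf : RatPoly f) (hg : RatPoly g) :
    RatPoly fun x => f x - g x := by
  simpa [sub_eq_add_neg] using linear 1 (-1) hf hg

theorem natCast_mul (n : ℕ) {f : (ℕ → ℝ) → ℝ} (hf : RatPoly f) :
    RatPoly fun x => n * f x := by
  simpa using linear n 0 hf hf

theorem div_natCast {n : ℕ} (hn : 0 < n) {f : (ℕ → ℝ) → ℝ} (hf : RatPoly f) :
    RatPoly fun x => f x / n := by
  obtain ⟨c, p, hc, hp⟩ := hf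
  refine ⟨c * n, p, Nat.mul_pos hc hn, fun x => ?_⟩
  rw [hp]
  push_cast
  field_simp

end RatPoly

/-- The set of the real points with the property `P` is defined by a formula. -/
def Definable (P : (ℕ → ℝ) → Prop) : Prop :=
  ∃ φ : Formula, ∀ x, φ.Holds x ↔ P x

namespace Definable

/-- A positive multiple of `f - g` has the same sign, so denominators can be cleared to reach
integer coefficients. -/
theorem le {f g : (ℕ → ℝ) → ℝ} (hf : RatPoly f) (hg : RatPoly g) :
    Definable fun x => f x ≤ g x := by
  obtain ⟨c, p, hc, hp⟩ := hf.sub hg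
  refine ⟨.atom .le p, fun x => ?_⟩
  have : (0 : ℝ) < c := by exact_mod_cast hc
  simp [Formula.Holds, Rel.Holds, hp, mul_nonpos_iff_pos_imp_nonpos, this, this.le]

theorem and {P Q : (ℕ → ℝ) → Prop} (hP : Definable P) (hQ : Definable Q) :
    Definable fun x => P x ∧ Q x :=
  let ⟨φ, hφ⟩ := hP
  let ⟨ψ, hψ⟩ := hQ
  ⟨.and φ ψ, fun x => by simp [Formula.Holds, hφ, hψ]⟩

theorem or {P Q : (ℕ → ℝ) → Prop} (hP : Definable P) (hQ : Definable Q) :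
    Definable fun x => P x ∨ Q x :=
  let ⟨φ, hφ⟩ := hP
  let ⟨ψ, hψ⟩ := hQ
  ⟨.or φ ψ, fun x => by simp [Formula.Holds, hφ, hψ]⟩

theorem eq {f g : (ℕ → ℝ) → ℝ} (hf : RatPoly f) (hg : RatPoly g) :
    Definable fun x => f x = g x := by
  simpa [le_antisymm_iff] using (le hf hg).and (le hg hf)

theorem exists_mem {ι : Type} {s : Set ι} (hs : s.Finite) {P : ι → (ℕ → ℝ) → Prop}
    (h : ∀ i, Definable (P i)) : Definable fun x => ∃ i ∈ s, P i x := by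
  induction s, hs using Set.Finite.induction_on with
  -- The empty disjunction is `0 < 0`.
  | empty => exact ⟨.atom .lt [], fun x => by simp [Formula.Holds, Rel.Holds, Poly.eval]⟩
  | insert _ _ ih => simpa using (h _).or ih

theorem exists_finite {ι : Type} [Finite ι] {P : ι → (ℕ → ℝ) → Prop}
    (h : ∀ i, Definable (P i)) : Definable fun x => ∃ i, P i x := by
  simpa using exists_mem Set.finite_univ h

theorem forall_finite {ι : Type} [Finite ι] {P : ι → (ℕ → ℝ) → Prop}
    (h : ∀ i, Definable (P i)) : Definable fun x => ∀ i, P i x := by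
  have key (s : Set ι) (hs : s.Finite) : Definable fun x => ∀ i ∈ s, P i x := by
    induction s, hs using Set.Finite.induction_on with
    | empty => exact ⟨.atom .eq [], fun x => by simp [Formula.Holds, Rel.Holds, Poly.eval]⟩
    | insert _ _ ih => simpa using (h _).and ih
  simpa using key _ Set.finite_univ

end Definable

/-! ### Sequences of real points -/

/-- The point `x` split into a sequence of points. -/
def slice (x : ℕ → ℝ) (t j : ℕ) : ℝ := x (2 ^ t * (2 * j + 1))

/-- A positive integer is a power of two times an odd number in only one way, so the points at
different times can be prescribed independently. -/
theorem slice_surjective : Surjective slice := by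
  have hinj : Injective fun a : ℕ × ℕ => 2 ^ a.1 * (2 * a.2 + 1) := by
    rintro ⟨t, j⟩ ⟨s, k⟩ h
    dsimp only at h
    wlog hts : t ≤ s generalizing t s j k
    · exact (this s k t j h.symm (by omega)).symm
    obtain ⟨d, rfl⟩ := Nat.exists_eq_add_of_le hts
    rw [pow_add, mul_assoc] at h
    have h := Nat.eq_of_mul_eq_mul_left (by positivity) h
    cases d with
    | zero => simpa using h
    | succ d =>
      rw [pow_succ', mul_assoc] at h
      omega
  intro y
  refine ⟨extend (fun a : ℕ × ℕ => 2 ^ a.1 * (2 * a.2 + 1)) (fun a => y a.1 a.2) 0, ?_⟩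
  ext t j
  exact hinj.extend_apply (fun a => y a.1 a.2) 0 (t, j)

/-- The formula `φ` defines the set `P` of points, in the variables with even indices. -/
def Formula.Defines (φ : Formula) (P : (ℕ → ℝ) → Prop) : Prop :=
  ∀ x, φ.Holds x ↔ P fun j => x (2 * j)

/-- The formula `φ` defines the relation `R` between a point and the point after it, which are
given by the variables with indices `4j + 1` and `2j`. -/
def Formula.DefinesRel (φ : Formula) (R : (ℕ → ℝ) → (ℕ → ℝ) → Prop) : Prop :=
  ∀ x, φ.Holds x ↔ R (fun j => x (4 * j + 1)) fun j => x (2 * j)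

theorem Formula.Defines.shift {φ : Formula} {P : (ℕ → ℝ) → Prop} (h : φ.Defines P) (t : ℕ)
    (x : ℕ → ℝ) : (φ.shift t).Holds x ↔ P (slice x t) := by
  rw [Formula.holds_shift, h]
  rfl

/-- Because `2 ^ t * (4 * j + 2) = 2 ^ (t + 1) * (2 * j + 1)`, a single shift places both points
correctly. -/
theorem Formula.DefinesRel.shift {φ : Formula} {R : (ℕ → ℝ) → (ℕ → ℝ) → Prop}
    (h : φ.DefinesRel R) (t : ℕ) (x : ℕ → ℝ) :
    (φ.shift t).Holds x ↔ R (slice x (t + 1)) (slice x t) := by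
  have : (fun j => x (2 ^ t * (4 * j + 1 + 1))) = slice x (t + 1) := by
    ext j
    rw [slice]
    congr 1
    ring
  rw [Formula.holds_shift, h, this]
  rfl

theorem Formula.exists_holds_computation {acc run guess init : Formula} {inp : Bool → Formula}
    {Acc Init : (ℕ → ℝ) → Prop} {Run Guess : (ℕ → ℝ) → (ℕ → ℝ) → Prop}
    {Inp : Bool → (ℕ → ℝ) → (ℕ → ℝ) → Prop} (hacc : acc.Defines Acc) (hrun : run.DefinesRel Run)
    (hguess : guess.DefinesRel Guess) (hinit : init.Defines Init)
    (hinp : ∀ b, (inp b).DefinesRel (Inp b)) (T p : ℕ) (w : List Bool) :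
    (∃ x, (Formula.computation acc run guess init inp T p w).Holds x) ↔
      ∃ y : ℕ → ℕ → ℝ, Init (y (T + w.length + p)) ∧
        (∀ n < p, Guess (y (T + w.length + n + 1)) (y (T + w.length + n))) ∧
        (∀ n (h : n < w.length), Inp w[n] (y (T + n + 1)) (y (T + n))) ∧
        (∀ n < T, Run (y (n + 1)) (y n)) ∧ Acc (y 0) := by
  rw [slice_surjective.exists]
  refine exists_congr fun x => ?_
  simp only [Formula.computation, Formula.chain_append, Formula.Holds, Formula.holds_chain,
    hacc.shift, hinit.shift, List.getElem_replicate, List.getElem_map, hrun.shift, hguess.shift,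
    (hinp _).shift, List.length_replicate, List.length_map, List.length_append, zero_add]
  tauto

/-! ### Coding the configurations of a Turing machine by real points -/

/-- The symbols that a statement pushes. -/
def pushed {K : Type} {Γ : K → Type} {Λ σ : Type} : TM2.Stmt Γ Λ σ → Set (Σ k, Γ k)
  | .push k f q => Set.range (fun v => ⟨k, f v⟩) ∪ pushed q
  | .peek _ _ q => pushed q
  | .pop _ _ q => pushed q
  | .load _ q => pushed q
  | .branch _ q₁ q₂ => pushed q₁ ∪ pushed q₂
  | .goto _ => ∅
  | .halt => ∅

/-- `FinTM2` does not make all stack alphabets finite. Pushed symbols are functions of the internal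
state, so only finitely many can ever appear beyond those of the input. -/
theorem finite_pushed {K : Type} {Γ : K → Type} {Λ σ : Type} [Finite σ] (q : TM2.Stmt Γ Λ σ) :
    (pushed q).Finite := by
  induction q with
  | push k f q ih => exact (Set.finite_range _).union ih
  | branch f q₁ q₂ ih₁ ih₂ => exact ih₁.union ih₂
  | goto f => exact Set.finite_empty
  | halt => exact Set.finite_empty
  | _ _ _ ih => assumption

/-- A finite set of symbols that contains all those which a machine pushes, and numbers for these
symbols, for the control states of the machine, and for its stacks. -/
structure Coding (tm : FinTM2) where
  /-- The symbols. -/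
  syms : Set (Σ k, tm.Γ k)
  finite_syms : syms.Finite
  pushed_subset : ∀ l, pushed (tm.m l) ⊆ syms
  /-- The numbers of the symbols. -/
  num : (Σ k, tm.Γ k) → ℕ
  /-- A bound for the numbers of the symbols. -/
  base : ℕ
  base_pos : 0 < base
  num_lt : ∀ a ∈ syms, num a < base
  num_injOn : Set.InjOn num syms
  /-- The numbers of the control states. -/
  ctl : Option tm.Λ × tm.σ → ℕ
  ctl_injective : Injective ctl
  /-- The numbers of the stacks. -/
  idx : tm.K → ℕ
  idx_injective : Injective idx

theorem Coding.exists (tm : FinTM2) {s : Set (Σ k, tm.Γ k)} (hs : s.Finite) :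
    ∃ C : Coding tm, s ⊆ C.syms := by
  have := tm.kFin
  have := tm.ΛFin
  have := tm.σFin
  obtain ⟨ctl, hctl⟩ := Countable.exists_injective_nat (Option tm.Λ × tm.σ)
  obtain ⟨idx, hidx⟩ := Countable.exists_injective_nat tm.K
  have hfin : (s ∪ ⋃ l, pushed (tm.m l)).Finite :=
    hs.union (Set.finite_iUnion fun l => finite_pushed _)
  obtain ⟨num, hnum⟩ := Set.countable_iff_exists_injOn.1 hfin.countable
  obtain ⟨b, hb⟩ := (hfin.image num).bddAbove
  exact ⟨⟨_, hfin, fun l => (Set.subset_iUnion (fun l => pushed (tm.m l)) l).trans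
    Set.subset_union_right, num, b + 1, b.succ_pos,
    fun a ha => Nat.lt_succ_of_le (hb (Set.mem_image_of_mem _ ha)), hnum, ctl, hctl,
    idx, hidx⟩, Set.subset_union_left⟩

namespace Coding

variable {tm : FinTM2} (C : Coding tm)

/-- The number of a stack with the symbol `a` on top of a stack with the number `r`. -/
noncomputable def cons {k : tm.K} (a : tm.Γ k) (r : ℝ) : ℝ :=
  ((2 * C.num ⟨k, a⟩ + 1 : ℕ) + r) / (2 * C.base : ℕ)

/-- The number of the stack below the symbol `a`. -/
noncomputable def uncons {k : tm.K} (a : tm.Γ k) (r : ℝ) : ℝ :=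
  (2 * C.base : ℕ) * r - (2 * C.num ⟨k, a⟩ + 1 : ℕ)

/-- The number that codes a stack. -/
noncomputable def stack {k : tm.K} : List (tm.Γ k) → ℝ
  | [] => 0
  | a :: l => C.cons a (stack l)

/-- All symbols on a stack belong to the set of symbols of the coding. -/
def Valid {k : tm.K} (l : List (tm.Γ k)) : Prop := ∀ a ∈ l, ⟨k, a⟩ ∈ C.syms

theorem uncons_cons {k : tm.K} (a b : tm.Γ k) (r : ℝ) :
    C.uncons a (C.cons b r) = 2 * ((C.num ⟨k, b⟩ : ℝ) - C.num ⟨k, a⟩) + r := by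
  have : (C.base : ℝ) ≠ 0 := by exact_mod_cast C.base_pos.ne'
  simp only [uncons, cons]
  push_cast
  field_simp
  ring

theorem stack_nonneg {k : tm.K} (l : List (tm.Γ k)) : 0 ≤ C.stack l := by
  induction l with
  | nil => exact le_rfl
  | cons a l ih => simp only [stack, cons]; positivity

theorem stack_cons_pos {k : tm.K} (a : tm.Γ k) (l : List (tm.Γ k)) : 0 < C.stack (a :: l) := by
  have := C.stack_nonneg l
  have := C.base_pos
  simp only [stack, cons]
  positivity

theorem stack_le_one {k : tm.K} {l : List (tm.Γ k)} (hl : C.Valid l) : C.stack l ≤ 1 := by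
  induction l with
  | nil => exact zero_le_one
  | cons a l ih =>
    have h₁ := ih fun b hb => hl b (List.mem_cons_of_mem _ hb)
    have h₂ : (C.num ⟨k, a⟩ : ℝ) + 1 ≤ C.base := by
      exact_mod_cast C.num_lt _ (hl a List.mem_cons_self)
    have : (0 : ℝ) < C.base := by exact_mod_cast C.base_pos
    simp only [stack, cons]
    push_cast
    rw [div_le_one (by positivity)]
    linarith

/-- Removing a wrong top symbol shifts the code of the rest, which lies in `[0, 1]`, by a nonzero
even integer, and so out of that interval. -/
theorem uncons_mem_iff {k : tm.K} {a b : tm.Γ k} {l : List (tm.Γ k)} (ha : ⟨k, a⟩ ∈ C.syms)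
    (hl : C.Valid (b :: l)) :
    (0 ≤ C.uncons a (C.stack (b :: l)) ∧ C.uncons a (C.stack (b :: l)) ≤ 1) ↔ a = b := by
  have h₀ := C.stack_nonneg l
  have h₁ := C.stack_le_one fun c hc => hl c (List.mem_cons_of_mem _ hc)
  simp only [stack, uncons_cons]
  constructor
  · rintro ⟨h₂, h₃⟩
    have h := C.num_injOn ha (hl b List.mem_cons_self) ?_
    · simpa using h
    by_contra hne
    rcases Nat.lt_or_gt_of_ne hne with h | h
    · have : (C.num ⟨k, a⟩ : ℝ) + 1 ≤ C.num ⟨k, b⟩ := by exact_mod_cast h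
      linarith
    · have : (C.num ⟨k, b⟩ : ℝ) + 1 ≤ C.num ⟨k, a⟩ := by exact_mod_cast h
      linarith
  · rintro rfl
    simpa using ⟨h₀, h₁⟩

/-- The point `y` has the control state `c` and the stacks `s`. -/
def Matches (y : ℕ → ℝ) (c : Option tm.Λ × tm.σ) (s : tm.K → ℝ) : Prop :=
  y 0 = C.ctl c ∧ ∀ k, y (C.idx k + 1) = s k

/-- The point `y` codes a configuration. -/
def Codes (y : ℕ → ℝ) (c : TM2.Cfg tm.Γ tm.Λ tm.σ) : Prop :=
  C.Matches y (c.l, c.var) fun k => C.stack (c.stk k)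

/-- The stacks that a point codes. -/
def stks (y : ℕ → ℝ) (k : tm.K) : ℝ := y (C.idx k + 1)

/-- The point `y` codes the result of a statement, in the internal state `v` with stacks `s`. -/
def Result : TM2.Stmt tm.Γ tm.Λ tm.σ → tm.σ → (tm.K → ℝ) → (ℕ → ℝ) → Prop
  | .push k f q, v, s, y => Result q v (update s k (C.cons (f v) (s k))) y
  | .peek k f q, v, s, y =>
    (∃ a ∈ {a | ⟨k, a⟩ ∈ C.syms}, (0 ≤ C.uncons a (s k) ∧ C.uncons a (s k) ≤ 1) ∧
      Result q (f v (some a)) s y) ∨ (s k = 0 ∧ Result q (f v none) s y)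
  | .pop k f q, v, s, y =>
    (∃ a ∈ {a | ⟨k, a⟩ ∈ C.syms}, (0 ≤ C.uncons a (s k) ∧ C.uncons a (s k) ≤ 1) ∧
      Result q (f v (some a)) (update s k (C.uncons a (s k))) y) ∨
    (s k = 0 ∧ Result q (f v none) s y)
  | .load f q, v, s, y => Result q (f v) s y
  | .branch f q₁ q₂, v, s, y => cond (f v) (Result q₁ v s y) (Result q₂ v s y)
  | .goto f, v, s, y => C.Matches y (some (f v), v) s
  | .halt, v, s, y => C.Matches y (none, v) s

theorem stack_update (S : ∀ k, List (tm.Γ k)) (k : tm.K) (l : List (tm.Γ k)) :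
    (fun k' => C.stack (update S k l k')) = update (fun k' => C.stack (S k')) k (C.stack l) := by
  ext k'
  rcases eq_or_ne k' k with rfl | h
  · simp
  · simp [h]

theorem valid_update {S : ∀ k, List (tm.Γ k)} (hS : ∀ k, C.Valid (S k)) {k : tm.K}
    {l : List (tm.Γ k)} (hl : C.Valid l) (k' : tm.K) : C.Valid (update S k l k') := by
  rcases eq_or_ne k' k with rfl | h
  · simpa
  · simpa [h] using hS k'

theorem valid_cons {k : tm.K} {a : tm.Γ k} {l : List (tm.Γ k)} :
    C.Valid (a :: l) ↔ ⟨k, a⟩ ∈ C.syms ∧ C.Valid l := by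
  simp [Valid]

/-- The interval test has exactly one solution `a` on a nonempty stack and none on the empty one,
whose code 0 differs from all others. Thus the disjunction simulates the case distinction of a pop.
-/
theorem exists_uncons_iff {k : tm.K} {l : List (tm.Γ k)} (hl : C.Valid l)
    (P : tm.Γ k → ℝ → Prop) (Q : Prop) :
    ((∃ a ∈ {a | ⟨k, a⟩ ∈ C.syms}, (0 ≤ C.uncons a (C.stack l) ∧ C.uncons a (C.stack l) ≤ 1) ∧
      P a (C.uncons a (C.stack l))) ∨ (C.stack l = 0 ∧ Q)) ↔
    l.head?.elim Q fun a => P a (C.stack l.tail) := by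
  cases l with
  | nil =>
    have (a : tm.Γ k) : C.uncons a 0 < 0 := by
      simp only [uncons, mul_zero, zero_sub, Left.neg_neg_iff]
      positivity
    simp [stack, (this _).not_ge]
  | cons b l =>
    simp only [(C.stack_cons_pos b l).ne', false_and, or_false]
    have h : C.uncons b (C.stack (b :: l)) = C.stack l := by simp [stack, uncons_cons]
    constructor
    · rintro ⟨a, ha, h₁, h₂⟩
      obtain rfl := (C.uncons_mem_iff ha hl).1 h₁
      rwa [h] at h₂
    · intro hP
      have hb := (C.valid_cons.1 hl).1
      exact ⟨b, hb, (C.uncons_mem_iff hb hl).2 rfl, by rwa [h]⟩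

theorem result_iff {q : TM2.Stmt tm.Γ tm.Λ tm.σ} (hq : pushed q ⊆ C.syms) {v : tm.σ}
    {S : ∀ k, List (tm.Γ k)} (hS : ∀ k, C.Valid (S k)) {y : ℕ → ℝ} :
    C.Result q v (fun k => C.stack (S k)) y ↔ C.Codes y (TM2.stepAux q v S) := by
  induction q generalizing v S with
  | push k f q ih =>
    rw [pushed, Set.union_subset_iff] at hq
    rw [Result, TM2.stepAux, ← ih hq.2 (C.valid_update hS
      (C.valid_cons.2 ⟨hq.1 (Set.mem_range_self v), hS k⟩)), stack_update, stack]
  | peek k f q ih =>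
    rw [Result, TM2.stepAux, C.exists_uncons_iff (hS k)
      (fun a _ => C.Result q (f v (some a)) (fun k => C.stack (S k)) y)]
    cases h : S k <;> exact ih hq hS
  | pop k f q ih =>
    rw [Result, TM2.stepAux, C.exists_uncons_iff (hS k) (fun a r =>
      C.Result q (f v (some a)) (update (fun k => C.stack (S k)) k r) y)]
    have hv : C.Valid (S k).tail := fun a ha => hS k a (List.mem_of_mem_tail ha)
    rw [← ih hq (C.valid_update hS hv), stack_update]
    cases h : S k with
    | nil =>
      simp only [List.head?_nil, List.tail_nil, Option.elim_none]
      rw [← h, update_eq_self k (fun k => C.stack (S k))]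
    | cons a l => rfl
  | load f q ih => exact ih hq hS
  | branch f q₁ q₂ ih₁ ih₂ =>
    rw [pushed, Set.union_subset_iff] at hq
    rw [Result, TM2.stepAux]
    cases f v
    · exact ih₂ hq.2 hS
    · exact ih₁ hq.1 hS
  | goto f => rfl
  | halt => rfl

theorem valid_stepAux {q : TM2.Stmt tm.Γ tm.Λ tm.σ} (hq : pushed q ⊆ C.syms) {v : tm.σ}
    {S : ∀ k, List (tm.Γ k)} (hS : ∀ k, C.Valid (S k)) (k : tm.K) :
    C.Valid ((TM2.stepAux q v S).stk k) := by
  induction q generalizing v S with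
  | push k f q ih =>
    rw [pushed, Set.union_subset_iff] at hq
    exact ih hq.2 (C.valid_update hS (C.valid_cons.2 ⟨hq.1 (Set.mem_range_self v), hS k⟩))
  | peek k f q ih => exact ih hq hS
  | pop k f q ih =>
    exact ih hq (C.valid_update hS fun a ha => hS k a (List.mem_of_mem_tail ha))
  | load f q ih => exact ih hq hS
  | branch f q₁ q₂ ih₁ ih₂ =>
    rw [pushed, Set.union_subset_iff] at hq
    rw [TM2.stepAux]
    cases f v
    · exact ih₂ hq.2 hS
    · exact ih₁ hq.1 hS
  | goto f => exact hS k
  | halt => exact hS k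

/-! ### Definability of the coded computation -/

theorem definable_matches {y : (ℕ → ℝ) → ℕ → ℝ} (hy : ∀ j, RatPoly fun x => y x j)
    {s : tm.K → (ℕ → ℝ) → ℝ} (hs : ∀ k, RatPoly (s k)) (c : Option tm.Λ × tm.σ) :
    Definable fun x => C.Matches (y x) c fun k => s k x := by
  have := tm.kFin
  exact (Definable.eq (hy 0) (.natCast _)).and
    (Definable.forall_finite fun k => Definable.eq (hy _) (hs k))

theorem ratPoly_cons {k : tm.K} (a : tm.Γ k) {f : (ℕ → ℝ) → ℝ} (hf : RatPoly f) :
    RatPoly fun x => C.cons a (f x) :=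
  .div_natCast (Nat.mul_pos two_pos C.base_pos) ((RatPoly.natCast _).add hf)

theorem ratPoly_uncons {k : tm.K} (a : tm.Γ k) {f : (ℕ → ℝ) → ℝ} (hf : RatPoly f) :
    RatPoly fun x => C.uncons a (f x) :=
  (hf.natCast_mul _).sub (.natCast _)

theorem update_family {K : Type} [DecidableEq K] (s : K → (ℕ → ℝ) → ℝ) (k : K)
    (f : (ℕ → ℝ) → ℝ) (x : ℕ → ℝ) :
    update (fun k' => s k' x) k (f x) = fun k' => update s k f k' x := by
  ext k'
  rcases eq_or_ne k' k with rfl | h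
  · simp
  · simp [h]

theorem ratPoly_update {K : Type} [DecidableEq K] {s : K → (ℕ → ℝ) → ℝ}
    (hs : ∀ k, RatPoly (s k)) {k : K} {f : (ℕ → ℝ) → ℝ} (hf : RatPoly f) (k' : K) :
    RatPoly (update s k f k') := by
  rcases eq_or_ne k' k with rfl | h
  · simpa
  · simpa [h] using hs k'

/-- The internal state is a constant along each branch and the stacks stay rational polynomials in
the variables; the value read from a stack is handled by a finite disjunction. -/
theorem definable_result {y : (ℕ → ℝ) → ℕ → ℝ} (hy : ∀ j, RatPoly fun x => y x j)
    (q : TM2.Stmt tm.Γ tm.Λ tm.σ) (v : tm.σ) {s : tm.K → (ℕ → ℝ) → ℝ}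
    (hs : ∀ k, RatPoly (s k)) : Definable fun x => C.Result q v (fun k => s k x) (y x) := by
  have hfin (k : tm.K) : {a | ⟨k, a⟩ ∈ C.syms}.Finite :=
    C.finite_syms.preimage sigma_mk_injective.injOn
  have hmem {k : tm.K} (a : tm.Γ k) {f : (ℕ → ℝ) → ℝ} (hf : RatPoly f) :
      Definable fun x => 0 ≤ C.uncons a (f x) ∧ C.uncons a (f x) ≤ 1 := by
    simpa using (Definable.le (.natCast 0) (C.ratPoly_uncons a hf)).and
      (Definable.le (C.ratPoly_uncons a hf) (.natCast 1))
  have hzero {f : (ℕ → ℝ) → ℝ} (hf : RatPoly f) : Definable fun x => f x = 0 := by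
    simpa using Definable.eq hf (.natCast 0)
  induction q generalizing v s with
  | push k f q ih =>
    have h := ih v (ratPoly_update hs (C.ratPoly_cons (f v) (hs k)) (k := k))
    simpa only [Result, ← update_family] using h
  | peek k f q ih =>
    exact .or (.exists_mem (hfin k) fun a => (hmem a (hs k)).and (ih _ hs))
      ((hzero (hs k)).and (ih _ hs))
  | pop k f q ih =>
    refine .or (.exists_mem (hfin k) fun a => (hmem a (hs k)).and ?_) ((hzero (hs k)).and (ih _ hs))
    have h := ih (f v (some a)) (ratPoly_update hs (C.ratPoly_uncons a (hs k)) (k := k))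
    simpa only [← update_family] using h
  | load f q ih => exact ih _ hs
  | branch f q₁ q₂ ih₁ ih₂ =>
    simp only [Result]
    cases f v
    · exact ih₂ v hs
    · exact ih₁ v hs
  | goto f => exact C.definable_matches hy hs _
  | halt => exact C.definable_matches hy hs _

end Coding

/-! ### The computation of a verifier -/

theorem evalPolynomial_mono (p : Polynomial ℕ) {m n : ℕ} (h : m ≤ n) : p.eval m ≤ p.eval n := by
  simp only [Polynomial.eval_eq_sum_range]
  gcongr

/-- A step of a machine that stays in the halting configurations. -/
def next (tm : FinTM2) (c : TM2.Cfg tm.Γ tm.Λ tm.σ) : TM2.Cfg tm.Γ tm.Λ tm.σ :=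
  (TM2.step tm.m c).getD c

/-- The start configuration with the input `l`. -/
def start (tm : FinTM2) (l : List (tm.Γ tm.k₀)) : TM2.Cfg tm.Γ tm.Λ tm.σ :=
  ⟨some tm.main, tm.initialState, update (fun _ => []) tm.k₀ l⟩

theorem initList_eq_start (tm : FinTM2) (l : List (tm.Γ tm.k₀)) : initList tm l = start tm l := by
  refine congrArg (TM2.Cfg.mk _ _) (funext fun k => ?_)
  rcases eq_or_ne k tm.k₀ with rfl | h
  · simp
  · simp [h]

theorem haltList_stk (tm : FinTM2) (l : List (tm.Γ tm.k₁)) :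
    TM2.Cfg.stk (haltList tm l) tm.k₁ = l := by
  simp [haltList]

/-- Halting configurations are fixed by `next`, so a run of unknown length can be padded to a length
`N` known in advance. -/
theorem iterate_next_of_evals {tm : FinTM2} {c d : TM2.Cfg tm.Γ tm.Λ tm.σ} (hd : d.l = none)
    {n N : ℕ} (hN : n ≤ N) (h : (flip bind (TM2.step tm.m))^[n] (some c) = some d) :
    (next tm)^[N] c = d := by
  induction N generalizing n c with
  | zero =>
    obtain rfl : n = 0 := by omega
    simpa using h
  | succ N ih =>
    rw [iterate_succ_apply]
    cases n with
    | zero =>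
      obtain rfl : c = d := by simpa using h
      have : next tm c = c := by
        obtain ⟨l, v, S⟩ := c
        obtain rfl : l = none := hd
        rfl
      rw [this]
      exact ih (Nat.zero_le _) rfl
    | succ n =>
      rw [iterate_succ_apply] at h
      refine ih (n := n) (by omega) ?_
      obtain ⟨_ | l, v, S⟩ := c
      · have hnone (n : ℕ) : (flip bind (TM2.step tm.m))^[n] none = none := by
          induction n with
          | zero => rfl
          | succ n ih => rw [iterate_succ_apply]; exact ih
        exact absurd ((hnone n).symm.trans h) (by simp)
      · exact h

/-! ### Transitions and runs of coded configurations -/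

namespace Coding

variable {tm : FinTM2} (C : Coding tm)

/-- The point `y'` codes the configuration after the one that `y` codes. -/
def Next (y y' : ℕ → ℝ) : Prop :=
  ∃ c : Option tm.Λ × tm.σ, y 0 = C.ctl c ∧
    c.1.elim (C.Matches y' (none, c.2) (C.stks y)) fun l => C.Result (tm.m l) c.2 (C.stks y) y'

/-- The point `y'` codes a start configuration with the same stacks as in `y`. -/
def Keep (y y' : ℕ → ℝ) : Prop :=
  C.Matches y' (some tm.main, tm.initialState) (C.stks y)

/-- The point `y'` codes a start configuration with the stacks obtained from those in `y` by
pushing a symbol on the input. -/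
def Push (a : tm.Γ tm.k₀) (y y' : ℕ → ℝ) : Prop :=
  C.Matches y' (some tm.main, tm.initialState)
    (update (C.stks y) tm.k₀ (C.cons a (C.stks y tm.k₀)))

variable {C} {y y' : ℕ → ℝ}

theorem Codes.next_iff {c : TM2.Cfg tm.Γ tm.Λ tm.σ} (h : C.Codes y c)
    (hc : ∀ k, C.Valid (c.stk k)) : C.Next y y' ↔ C.Codes y' (next tm c) := by
  obtain ⟨l, v, S⟩ := c
  obtain ⟨h₀, h⟩ := h
  have hs : C.stks y = fun k => C.stack (S k) := funext h
  have huniq : C.Next y y' ↔ (l.elim (C.Matches y' (none, v) (C.stks y))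
      fun l => C.Result (tm.m l) v (C.stks y) y') := by
    constructor
    · rintro ⟨c, hc, h'⟩
      obtain rfl := C.ctl_injective (hc.symm.trans h₀ |> Nat.cast_injective)
      exact h'
    · exact fun h' => ⟨(l, v), h₀, h'⟩
  rw [huniq, hs]
  cases l with
  | none => rfl
  | some l => exact C.result_iff (C.pushed_subset l) hc

theorem Codes.keep_iff {l : List (tm.Γ tm.k₀)} (h : C.Codes y (start tm l)) :
    C.Keep y y' ↔ C.Codes y' (start tm l) := by
  have hs : C.stks y = fun k => C.stack ((start tm l).stk k) := funext h.2
  rw [Keep, hs]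
  rfl

theorem Codes.push_iff {l : List (tm.Γ tm.k₀)} (h : C.Codes y (start tm l)) (a : tm.Γ tm.k₀) :
    C.Push a y y' ↔ C.Codes y' (start tm (a :: l)) := by
  have hs : C.stks y = fun k => C.stack ((start tm l).stk k) := funext h.2
  have hk : (start tm l).stk tm.k₀ = l := by simp [start]
  have hu : (start tm (a :: l)).stk = update (start tm l).stk tm.k₀ (a :: l) := by
    simp [start]
  simp only [Push, hs, hk]
  rw [Codes, hu, stack_update]
  rfl

theorem exists_codes (C : Coding tm) (c : TM2.Cfg tm.Γ tm.Λ tm.σ) : ∃ y, C.Codes y c := by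
  refine ⟨fun | 0 => C.ctl (c.l, c.var) | n + 1 => extend C.idx (fun k => C.stack (c.stk k)) 0 n,
    rfl, fun k => C.idx_injective.extend_apply _ _ k⟩

theorem valid_next (C : Coding tm) {c : TM2.Cfg tm.Γ tm.Λ tm.σ} (hc : ∀ k, C.Valid (c.stk k))
    (k : tm.K) : C.Valid ((next tm c).stk k) := by
  obtain ⟨_ | l, v, S⟩ := c
  · exact hc k
  · exact C.valid_stepAux (C.pushed_subset l) hc k

theorem valid_iterate_next (C : Coding tm) {c : TM2.Cfg tm.Γ tm.Λ tm.σ}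
    (hc : ∀ k, C.Valid (c.stk k)) (n : ℕ) (k : tm.K) : C.Valid (((next tm)^[n] c).stk k) := by
  induction n generalizing c with
  | zero => exact hc k
  | succ n ih => exact ih (C.valid_next hc)

theorem valid_start (C : Coding tm) {l : List (tm.Γ tm.k₀)} (hl : C.Valid l) (k : tm.K) :
    C.Valid ((start tm l).stk k) :=
  C.valid_update (S := fun _ => []) (fun _ _ ha => absurd ha List.not_mem_nil) hl k

/-- The coded computations correspond to the guesses of a word `w`. -/
theorem exists_computation_iff (C : Coding tm) (s : Bool ⊕ Bool → tm.Γ tm.k₀)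
    (hs : ∀ a, ⟨tm.k₀, s a⟩ ∈ C.syms) (T p : ℕ) (x : List Bool) (Acc : (ℕ → ℝ) → Prop) :
    (∃ y : ℕ → ℕ → ℝ, C.Codes (y (T + x.length + p)) (start tm []) ∧
        (∀ n < p, C.Keep (y (T + x.length + n + 1)) (y (T + x.length + n)) ∨
          ∃ b, C.Push (s (.inr b)) (y (T + x.length + n + 1)) (y (T + x.length + n))) ∧
        (∀ n (h : n < x.length), C.Push (s (.inl x[n])) (y (T + n + 1)) (y (T + n))) ∧
        (∀ n < T, C.Next (y (n + 1)) (y n)) ∧ Acc (y 0)) ↔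
      ∃ w : List Bool, w.length ≤ p ∧ ∃ y₀, C.Codes y₀
        ((next tm)^[T] (start tm ((x.map Sum.inl ++ w.map Sum.inr).map s))) ∧ Acc y₀ := by
  have hv (l : List (Bool ⊕ Bool)) : ∀ k, C.Valid ((start tm (l.map s)).stk k) :=
    C.valid_start fun a ha => by
      obtain ⟨b, -, rfl⟩ := List.mem_map.1 ha
      exact hs b
  constructor
  · rintro ⟨y, hinit, hguess, hinp, hrun, hacc⟩
    -- The guessing steps go from index `j + 1` to `j` and add at most one letter each, whence the
    -- invariant `w.length + j ≤ p`.
    have h₁ : ∃ w : List Bool, w.length + 0 ≤ p ∧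
        C.Codes (y (T + x.length + 0)) (start tm ((w.map Sum.inr).map s)) := by
      refine Nat.decreasingInduction (n := p) (motive := fun j _ => ∃ w : List Bool,
        w.length + j ≤ p ∧ C.Codes (y (T + x.length + j)) (start tm ((w.map Sum.inr).map s)))
        ?_ ⟨[], by simp, hinit⟩ p.zero_le
      rintro j hj ⟨w, hw, h⟩
      rcases hguess j hj with h' | ⟨b, h'⟩
      · exact ⟨w, by omega, h.keep_iff.1 h'⟩
      · exact ⟨b :: w, by simp; omega, (h.push_iff _).1 h'⟩
    obtain ⟨w, hw, h₁⟩ := h₁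
    have h₂ : C.Codes (y (T + 0)) (start tm (((x.drop 0).map Sum.inl ++ w.map Sum.inr).map s)) := by
      refine Nat.decreasingInduction (n := x.length) (motive := fun j _ =>
        C.Codes (y (T + j)) (start tm (((x.drop j).map Sum.inl ++ w.map Sum.inr).map s)))
        ?_ (by simpa using h₁) x.length.zero_le
      intro j hj h
      rw [List.drop_eq_getElem_cons hj]
      exact (h.push_iff _).1 (hinp j hj)
    have h₃ : C.Codes (y 0)
        ((next tm)^[T - 0] (start tm ((x.map Sum.inl ++ w.map Sum.inr).map s))) := by
      refine Nat.decreasingInduction (n := T) (motive := fun j _ =>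
        C.Codes (y j) ((next tm)^[T - j] (start tm ((x.map Sum.inl ++ w.map Sum.inr).map s))))
        ?_ (by simpa using h₂) T.zero_le
      intro j hj h
      rw [show T - j = T - (j + 1) + 1 by omega, iterate_succ_apply']
      exact (h.next_iff (C.valid_iterate_next (hv _) _)).1 (hrun j hj)
    exact ⟨w, hw, y 0, h₃, hacc⟩
  · rintro ⟨w, hw, y₀, hy₀, hacc⟩
    choose pt hpt using C.exists_codes
    set W := x.map Sum.inl ++ w.map Sum.inr with hW
    -- Truncated subtraction covers both phases: above `T` no step has been made and only a suffix
    -- of `W` is written; below `T` the input is complete.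
    let cfg (t : ℕ) := (next tm)^[T - t] (start tm ((W.drop (t - T)).map s))
    let y (t : ℕ) := if t = 0 then y₀ else pt (cfg t)
    have hy (t : ℕ) : C.Codes (y t) (cfg t) := by
      by_cases ht : t = 0
      · simpa [y, cfg, ht] using hy₀
      · simpa [y, ht] using hpt _
    have hcfg (t : ℕ) : cfg (T + t) = start tm ((W.drop t).map s) := by simp [cfg]
    refine ⟨y, ?_, fun n hn => ?_, fun n hn => ?_, fun n hn => ?_, by simpa [y] using hacc⟩
    · have h := hy (T + (x.length + p))
      rwa [hcfg, List.drop_eq_nil_of_le (by simp [hW]; omega), ← add_assoc] at h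
    · have h := hy (T + (x.length + n))
      have h' := hy (T + (x.length + n + 1))
      have hdrop (m : ℕ) : W.drop (x.length + m) = (w.drop m).map Sum.inr := by
        simp [hW, List.drop_append, List.map_drop]
      rw [hcfg, hdrop, ← add_assoc] at h
      rw [hcfg, add_assoc x.length, hdrop, ← add_assoc, ← add_assoc] at h'
      -- A witness shorter than `p` is padded by idle steps, which come first in machine time, while
      -- the input is empty.
      by_cases hnw : n < w.length
      · rw [List.drop_eq_getElem_cons hnw] at h
        exact .inr ⟨_, (h'.push_iff _).2 h⟩
      · rw [List.drop_eq_nil_of_le (by omega)] at h h'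
        exact .inl (h'.keep_iff.2 h)
    · have h := hy (T + n)
      have h' := hy (T + (n + 1))
      rw [hcfg] at h h'
      have hn' : n < W.length := by simp [hW]; omega
      rw [List.drop_eq_getElem_cons hn'] at h
      have hx : W[n] = .inl x[n] := by simp [hW, hn]
      rw [hx] at h
      exact (h'.push_iff _).2 h
    · have h := hy n
      have hstep : cfg n = next tm (cfg (n + 1)) := by
        simp only [cfg]
        rw [← iterate_succ_apply' (next tm), show n - T = 0 by omega, show n + 1 - T = 0 by omega,
          show T - n = T - (n + 1) + 1 by omega]
      rw [hstep] at h
      exact ((hy (n + 1)).next_iff (C.valid_iterate_next (hv _) _)).2 h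

theorem definable_next (C : Coding tm) :
    Definable fun x => C.Next (fun j => x (4 * j + 1)) fun j => x (2 * j) := by
  have := tm.ΛFin
  have := tm.σFin
  refine .exists_finite fun c => (Definable.eq (.var _) (.natCast _)).and ?_
  obtain ⟨_ | l, v⟩ := c
  · exact C.definable_matches (fun _ => .var _) (fun _ => .var _) _
  · exact C.definable_result (fun _ => .var _) _ v fun _ => .var _

theorem definable_keep (C : Coding tm) :
    Definable fun x => C.Keep (fun j => x (4 * j + 1)) fun j => x (2 * j) :=
  C.definable_matches (fun _ => .var _) (fun _ => .var _) _

theorem definable_push (C : Coding tm) (a : tm.Γ tm.k₀) :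
    Definable fun x => C.Push a (fun j => x (4 * j + 1)) fun j => x (2 * j) := by
  have h := C.definable_matches (y := fun x j => x (2 * j)) (fun _ => .var _)
    (ratPoly_update (s := fun k x => x (4 * (C.idx k + 1) + 1)) (fun _ => .var _)
      (C.ratPoly_cons a (.var (4 * (C.idx tm.k₀ + 1) + 1))) (k := tm.k₀))
    (some tm.main, tm.initialState)
  simp only [← update_family] at h
  exact h

theorem definable_start (C : Coding tm) :
    Definable fun x => C.Codes (fun j => x (2 * j)) (start tm []) := by
  refine C.definable_matches (fun _ => .var _) (s := fun k _ => C.stack ((start tm []).stk k))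
    (fun k => ?_) _
  have : (start tm []).stk k = [] := by simp [start]
  rw [this]
  simpa [stack] using RatPoly.natCast 0

theorem definable_output (C : Coding tm) (a : tm.Γ tm.k₁) :
    Definable fun x => C.stks (fun j => x (2 * j)) tm.k₁ = C.stack [a] :=
  .eq (.var _) (C.ratPoly_cons a (by simpa [stack] using RatPoly.natCast 0))

end Coding

end ExistsReal

/-! ### The reduction from a verifier to `ETR` -/

open Turing ExistsReal in
theorem mainTheorem11 : ExistsReal.NP ⊆ ExistsReal.ER := by
  rintro P ⟨A, p, ⟨⟨⟨tm, ein, eout⟩, time, hA⟩⟩, hP⟩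
  dsimp only at hA
  -- Input symbols must be coded since they are on the stack from the start; the two answer symbols
  -- are included so that their codes can be told apart.
  obtain ⟨C, hC⟩ := Coding.exists tm
    ((Set.finite_range fun a : Bool ⊕ Bool => (⟨tm.k₀, ein.symm a⟩ : Σ k, tm.Γ k)).union
      (Set.finite_range fun b : Bool => (⟨tm.k₁, eout.symm b⟩ : Σ k, tm.Γ k)))
  rw [Set.union_subset_iff, Set.range_subset_iff, Set.range_subset_iff] at hC
  obtain ⟨acc, hacc⟩ := C.definable_output (eout.symm true)
  obtain ⟨run, hrun⟩ := C.definable_next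
  obtain ⟨guess, hguess⟩ := C.definable_keep.or
    (Definable.exists_finite fun b => C.definable_push (ein.symm (.inr b)))
  obtain ⟨init, hinit⟩ := C.definable_start
  choose inp hinp using fun b => C.definable_push (ein.symm (.inl b))
  refine ⟨_, polyTimeFun_computation acc run guess init inp (time.comp (.X + p)) p, fun x => ?_⟩
  have hETR (φ : Formula) : φ.encode ∈ ETR ↔ ∃ y, φ.Holds y :=
    ⟨fun ⟨ψ, hψ, h⟩ => Formula.encode_injective hψ ▸ h, fun h => ⟨φ, rfl, h⟩⟩
  rw [hP, hETR, Formula.exists_holds_computation (Run := C.Next)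
    (Guess := fun y y' => C.Keep y y' ∨ ∃ b, C.Push (ein.symm (.inr b)) y y')
    (Acc := fun y => C.stks y tm.k₁ = C.stack [eout.symm true])
    (Init := fun y => C.Codes y (start tm [])) (Inp := fun b => C.Push (ein.symm (.inl b)))
    hacc hrun hguess hinit hinp]
  refine Iff.trans ?_ (C.exists_computation_iff ein.symm hC.1 _ _ x
    fun y => C.stks y tm.k₁ = C.stack [eout.symm true]).symm
  refine exists_congr fun w => and_congr_right fun hw => ?_
  have hhalt := iterate_next_of_evals (d := haltList tm [eout.symm (A (x, w))]) rfl
    ((hA (x, w)).steps_le_m.trans (?_ : _ ≤ (time.comp (.X + p)).eval x.length))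
    (c := start tm ((x.map Sum.inl ++ w.map Sum.inr).map ein.symm)) ?_
  rotate_left
  -- The verifier's input has length `|x| + |w|`. As `time` has natural coefficients, its value
  -- there is at most that at `|x| + p(|x|)`, which does not depend on `w`.
  · rw [Polynomial.eval_comp]
    refine evalPolynomial_mono _ ?_
    simpa [Computability.encodingProd, Computability.encodingList] using hw
  · rw [← initList_eq_start]
    exact (hA (x, w)).evals_in_steps
  rw [hhalt]
  have hout (y : ℕ → ℝ) (hy : C.Codes y (haltList tm [eout.symm (A (x, w))])) :
      C.stks y tm.k₁ = C.stack [eout.symm (A (x, w))] := by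
    exact (hy.2 tm.k₁).trans (congrArg C.stack (haltList_stk tm _))
  constructor
  · intro h
    obtain ⟨y, hy⟩ := C.exists_codes (haltList tm [eout.symm (A (x, w))])
    exact ⟨y, hy, by rw [hout y hy, h]⟩
  · rintro ⟨y, hy, h⟩
    rw [hout y hy] at h
    -- On one-letter stacks this leaves twice the difference of the two symbol numbers, which must
    -- vanish.
    have huncons := congrArg (C.uncons (eout.symm (A (x, w)))) h
    simp only [Coding.stack, Coding.uncons_cons, sub_self, mul_zero, add_zero] at huncons
    have hnum : C.num ⟨tm.k₁, eout.symm (A (x, w))⟩ = C.num ⟨tm.k₁, eout.symm true⟩ := by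
      have : (C.num ⟨tm.k₁, eout.symm (A (x, w))⟩ : ℝ) = C.num ⟨tm.k₁, eout.symm true⟩ := by
        linarith
      exact_mod_cast this
    have := C.num_injOn (hC.2 _) (hC.2 _) hnum
    simpa using this
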